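/- **Setting.** Consider a finite two-player zero-sum extensive-form game with chance: a finite prefix-closed set of histories (sequences over a finite set $\mathcal A$ of actions and chance outcomes), action sets $A(h)$, terminal histories $\mathcal Z$, utilities $r_1$ and $r_2=-r_1$ on $\mathcal Z$, a fixed chance policy, and for each player $i\in\{1,2\}$ a partition $\mathcal S_i$ of the histories where $i$ acts into non-empty information states $s$ with a common action set $A(s)$. Assume perfect recall: any two histories in $s\in\mathcal S_i$ have the same sequence of preceding information states of $i$ and of actions taken there by $i$. For a profile $\sigma=(\sigma_1,\sigma_2)$ of behavioral strategies let $\eta^\sigma(z)=\eta_i^\sigma(z)\,\eta_{-i}^\sigma(z)$ be the probability of reaching $z$, factored into the contribution of $i$ and that of the opponent and chance (and let $\eta^\sigma_i(h,z)$ be the contribution of $i$ from $h$ to $z$, zero if $z$ is unreachable from $h$); let $r_i(\sigma)=\sum_{z\in\mathcal Z}\eta^\sigma(z)r_i(z)$. For $s\in\mathcal S_i$ and $a\in A(s)$ the counterfactual value is $$v_i^\sigma(s,a)=\sum_{h\in s,\,z\in\mathcal Z}\eta_i^\sigma(ha,z)\,\eta_{-i}^\sigma(z)\,r_i(z).$$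 Let $U$ bound the rewards of the decision problems at the information states: $|v_i^\sigma(s,a)|\le U$ for all $\sigma,i,s,a$. For profiles $\sigma^1,\dots,\sigma^t$ (with $\sigma^k=(\sigma_{1,k},\sigma_{2,k})$) define the cumulative counterfactual regrets $$R_k(s,a)=\sum_{j=1}^{k}\Big(v_i^{\sigma^j}(s,a)-\sum_{a'\in A(s)}\sigma_{i,j}(s,a')\,v_i^{\sigma^j}(s,a')\Big),\qquad R_0=0,$$ and the external regret $R^{\mathrm{EXT}}_{i,t}=\max_{a^*}\sum_{k=1}^t\big(r_i(a^*,\sigma_{-i,k})-r_i(\sigma^k)\big)$, the maximum being over the pure strategies $a^*\in\prod_{s\in\mathcal S_i}A(s)$. **Algorithm.** Let $1<p\le 2$, $t\ge1$, $f(x)_a=(x_a^+)^{p-1}$ and $g(x)_a=p\,(x_a^+)^{p-1}$. Let $\tilde R_0,\tilde R_1,\dots$ be arbitrary estimates, $\tilde R_k(s)\in\mathbb R^{A(s)}$ (for instance the outputs of a function approximator). Suppose that both players follow $f$-RCFR: for $k=1,\dots,t$ and every information state $s$ of each player $i$, $\sigma_{i,k}(s)\in\Delta(A(s))$ satisfies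 $\sigma_{i,k}(s)\propto f(\tilde R_{k-1}(s))$ if $f(\tilde R_{k-1}(s))\ne0$ and is arbitrary otherwise. Put $$\epsilon_i(s)=\sum_{k=1}^t\big\|g(R_{k-1}(s))-g(\tilde R_{k-1}(s))\big\|_1,\qquad \epsilon_i^*=\max_{s\in\mathcal S_i}\epsilon_i(s),$$ $$\varepsilon_{i,t}=\frac1t\sum_{s\in\mathcal S_i}\Big(t(2U)^p(|A(s)|-1)+2U\,\epsilon_i(s)\Big)^{1/p}.$$ **Claim.** 1. For both players $i$, $$\frac1t R^{\mathrm{EXT}}_{i,t}\le\varepsilon_{i,t}\le\frac1t|\mathcal S_i|\Big(t(2U)^p(|\mathcal A|-1)+2U\,\epsilon_i^*\Big)^{1/p}$$ (if $\mathcal S_i=\emptyset$, the right-hand side is read as $0$). 2. Every profile $\bar\sigma^t$ of average sequence weight policies, i.e. $\bar\sigma_{i,t}(s)\propto\sum_{k=1}^t\sum_{h\in s}\eta_i^{\sigma^k}(h)\,\sigma_{i,k}(s)$ (arbitrary where this vector vanishes), is an $(\varepsilon_{1,t}+\varepsilon_{2,t})$-Nash equilibrium: no player can gain more than $\varepsilon_{1,t}+\varepsilon_{2,t}$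 by a unilateral change of policy. 3. For $p=2$ (RCFR) this is tighter than the previously known form of the bound, which has $|A(s)|$ in place of $|A(s)|-1$ and an extra factor $\sqrt{|A(s)|}$ on the errors: $$\varepsilon_{i,t}\le\frac1t\sum_{s\in\mathcal S_i}\sqrt{t(2U)^2|A(s)|+2U\sqrt{|A(s)|}\,\epsilon_i(s)},$$ with strict inequality if $U>0$ and $\mathcal S_i\ne\emptyset$. -/

import Mathlib

/-- A finite two-player zero-sum extensive-form game (with chance). `α` is the set of all actions
(including chance outcomes) and `ι` is the set of all information states of both players, so that
the information states of player `i` are the `s : ι` with `owner s = i`.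
The two players are `0` (the first player) and `1` (the second player). -/
structure EFG (α ι : Type*) [Fintype α] [Fintype ι] where
  /-- The histories: the valid sequences of actions and chance outcomes. -/
  hist : Finset (List α)
  nil_mem : [] ∈ hist
  prefix_mem : ∀ (h : List α) (a : α), h ++ [a] ∈ hist → h ∈ hist
  /-- The actions available at a history. -/
  actions : List α → Finset α
  mem_actions : ∀ h ∈ hist, ∀ a, a ∈ actions h ↔ h ++ [a] ∈ hist
  /-- Who acts at a non-terminal history: `none` means that chance acts, `some s` means that the
  player `owner s` acts and that the history belongs to the information state `s`. -/
  turn : List α → Option ι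
  /-- The player who acts at an information state. -/
  owner : ι → Fin 2
  /-- The actions available at an information state. -/
  infoActions : ι → Finset α
  /-- The actions at a history depend only on its information state. -/
  infoActions_eq : ∀ h ∈ hist, (actions h).Nonempty → ∀ s, turn h = some s →
    actions h = infoActions s
  /-- The cells of the information partition are non-empty. -/
  info_nonempty : ∀ s, ∃ h ∈ hist, (actions h).Nonempty ∧ turn h = some s
  /-- The fixed policy of chance. -/
  chance : List α → α → ℝ
  chance_nonneg : ∀ h ∈ hist, (actions h).Nonempty → turn h = none →
    ∀ a ∈ actions h, 0 ≤ chance h a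
  chance_sum : ∀ h ∈ hist, (actions h).Nonempty → turn h = none →
    ∑ a ∈ actions h, chance h a = 1
  /-- The utility of player `0` at terminal histories. -/
  r₁ : List α → ℝ

namespace EFG

variable {α ι : Type*} [Fintype α] [Fintype ι] (G : EFG α ι)

open Classical in
/-- The terminal histories: those without valid actions. -/
noncomputable def terminals : Finset (List α) := {z ∈ G.hist | G.actions z = ∅}

open Classical in
/-- The histories that make up the information state `s`. -/
noncomputable def cell (s : ι) : Finset (List α) :=
  {h ∈ G.hist | (G.actions h).Nonempty ∧ G.turn h = some s}

/-- The information states of player `i`. -/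
def infoStates (i : Fin 2) : Finset ι := {s | G.owner s = i}

/-- The utility of each player; the game is zero-sum. -/
def util (i : Fin 2) (z : List α) : ℝ := if i = 0 then G.r₁ z else -G.r₁ z

/-- The mover at a history: `none` is chance, `some i` is player `i`. -/
def mover (h : List α) : Option (Fin 2) := (G.turn h).map G.owner

/-- The sequence of information states of player `i` passed when the actions of the second list
are played from the history given as first list, with the actions that `i` takes there. -/
def ownSeq (i : Fin 2) : List α → List α → List (ι × α)
  | _, [] => []
  | h, a :: l =>
    match G.turn h with
    | none => ownSeq i (h ++ [a]) l
    | some s => if G.owner s = i then (s, a) :: ownSeq i (h ++ [a]) l else ownSeq i (h ++ [a]) l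

/-- Perfect recall: histories in one information state share the sequence of earlier information
states of the acting player and of the player's own actions there. -/
def PerfectRecall : Prop :=
  ∀ s, ∀ h ∈ G.cell s, ∀ h' ∈ G.cell s,
    G.ownSeq (G.owner s) [] h = G.ownSeq (G.owner s) [] h'

/-- `σ` is a joint policy (behavioral strategy profile): a probability distribution over the valid
actions at each information state. The policy of player `i` is the restriction of `σ` to the
information states of `i`. -/
def IsProfile (σ : ι → α → ℝ) : Prop :=
  ∀ s, (∀ a, 0 ≤ σ s a) ∧ (∀ a, a ∉ G.infoActions s → σ s a = 0) ∧
    ∑ a ∈ G.infoActions s, σ s a = 1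

/-- The profile in which player `i` follows `σ'` and the opponent follows `σ`. -/
def deviate (i : Fin 2) (σ' σ : ι → α → ℝ) : ι → α → ℝ :=
  fun s => if G.owner s = i then σ' s else σ s

/-- The probability of taking action `a` at history `h`. -/
def stepProb (σ : ι → α → ℝ) (h : List α) (a : α) : ℝ :=
  match G.turn h with
  | none => G.chance h a
  | some s => σ s a

open Classical in
/-- The contribution of the movers in `C` to the probability that the actions of the second list
are played in this order from the history given as first list. -/
noncomputable def reachFrom (C : Set (Option (Fin 2))) (σ : ι → α → ℝ) : List α → List α → ℝ
  | _, [] => 1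
  | h, a :: l => (if G.mover h ∈ C then G.stepProb σ h a else 1) * reachFrom C σ (h ++ [a]) l

/-- The contribution of the movers in `C` to the probability of reaching `h` from the start. -/
noncomputable def reach (C : Set (Option (Fin 2))) (σ : ι → α → ℝ) (h : List α) : ℝ :=
  G.reachFrom C σ [] h

open Classical in
/-- The contribution of the movers in `C` to the probability of reaching `z` from `h`; it is zero
if `z` cannot be reached from `h`. -/
noncomputable def reachBetween (C : Set (Option (Fin 2))) (σ : ι → α → ℝ) (h z : List α) : ℝ :=
  if h <+: z then G.reachFrom C σ h (z.drop h.length) else 0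

/-- The expected value to player `i` under the profile `σ`. -/
noncomputable def value (i : Fin 2) (σ : ι → α → ℝ) : ℝ :=
  ∑ z ∈ G.terminals, G.reach Set.univ σ z * G.util i z

/-- The counterfactual value of action `a` at the information state `s` to its owner: the owner's
own contribution counts only after the action, that of the opponent and chance from the start. -/
noncomputable def cfValue (σ : ι → α → ℝ) (s : ι) (a : α) : ℝ :=
  ∑ h ∈ G.cell s, ∑ z ∈ G.terminals,
    G.reachBetween {some (G.owner s)} σ (h ++ [a]) z * G.reach {some (G.owner s)}ᶜ σ z *
      G.util (G.owner s) z

/-- The instantaneous counterfactual regret. -/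
noncomputable def instRegret (σ : ι → α → ℝ) (s : ι) (a : α) : ℝ :=
  G.cfValue σ s a - ∑ a' ∈ G.infoActions s, σ s a' * G.cfValue σ s a'

/-- The cumulative counterfactual regret after `t` iterations with profiles `σ 1, …, σ t`. -/
noncomputable def cumRegret (σ : ℕ → ι → α → ℝ) (t : ℕ) (s : ι) (a : α) : ℝ :=
  ∑ k ∈ Finset.range t, G.instRegret (σ (k + 1)) s a

/-- The pure strategies of player `i`: one valid action at each information state of `i`. -/
abbrev PureStrategy (i : Fin 2) : Type _ :=
  (s : {s : ι // G.owner s = i}) → {a : α // a ∈ G.infoActions s}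

open Classical in
/-- The profile in which player `i` follows a pure strategy and the opponent follows `σ`. -/
noncomputable def playPure (i : Fin 2) (b : G.PureStrategy i) (σ : ι → α → ℝ) : ι → α → ℝ :=
  fun s a => if h : G.owner s = i then (if a = b ⟨s, h⟩ then 1 else 0) else σ s a

/-- The cumulative external regret of player `i` after `t` iterations with profiles
`σ 1, …, σ t`: the maximum over the finitely many pure strategies in hindsight. -/
noncomputable def extRegret (σ : ℕ → ι → α → ℝ) (t : ℕ) (i : Fin 2) : ℝ :=
  ⨆ b : G.PureStrategy i, ∑ k ∈ Finset.range t,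
    (G.value i (G.playPure i b (σ (k + 1))) - G.value i (σ (k + 1)))

/-- `q` is the normalization of the weights `w` on the finite set `A`, with no constraint when the
weights sum to zero. -/
def IsProportional (A : Finset α) (q w : α → ℝ) : Prop :=
  ∑ b ∈ A, w b ≠ 0 → ∀ a ∈ A, q a = w a / ∑ b ∈ A, w b

/-- The polynomial link function. -/
noncomputable def polyLink (p : ℝ) (x : α → ℝ) : α → ℝ := fun a => (max (x a) 0) ^ (p - 1)

/-- The profiles `σ 1, …, σ t` are those of `f`-RCFR with the regret estimates `R' k`, where
`R' k s` is the estimate of the cumulative counterfactual regrets at `s` after `k` iterations: the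
policy of iteration `k + 1` at `s` is proportional to `f (R' k s)`, and arbitrary where this
vanishes. An estimator `y k` on features `φ s a` is the case `R' k s a = y k (φ s a)`. -/
def IsRCFR (f : (α → ℝ) → α → ℝ) (R' : ℕ → ι → α → ℝ) (t : ℕ) (σ : ℕ → ι → α → ℝ) : Prop :=
  ∀ k < t, G.IsProfile (σ (k + 1)) ∧
    ∀ s, IsProportional (G.infoActions s) (σ (k + 1) s) (f (R' k s))

/-- The cumulative approximation error in `s` after `t` iterations, for the function
`g = p • polyLink p`. -/
noncomputable def approxError (p : ℝ) (R' : ℕ → ι → α → ℝ) (σ : ℕ → ι → α → ℝ) (t : ℕ)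
    (s : ι) : ℝ :=
  ∑ k ∈ Finset.range t, ∑ a ∈ G.infoActions s,
    |p * polyLink p (G.cumRegret σ k s) a - p * polyLink p (R' k s) a|

/-- The largest cumulative approximation error over the information states of player `i`. -/
noncomputable def maxApproxError (p : ℝ) (R' : ℕ → ι → α → ℝ) (σ : ℕ → ι → α → ℝ) (t : ℕ)
    (i : Fin 2) : ℝ :=
  ⨆ s : {s : ι // G.owner s = i}, G.approxError p R' σ t s

/-- `U` bounds the rewards of the online decision problems at the information states, that is, all
counterfactual values under all profiles. -/
def BoundsRewards (U : ℝ) : Prop :=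
  ∀ σ, G.IsProfile σ → ∀ s, ∀ a ∈ G.infoActions s, |G.cfValue σ s a| ≤ U

/-- The regret bound `ε_{i,t}`. -/
noncomputable def regretBound (p U : ℝ) (R' : ℕ → ι → α → ℝ) (σ : ℕ → ι → α → ℝ) (t : ℕ)
    (i : Fin 2) : ℝ :=
  1 / (t : ℝ) * ∑ s ∈ G.infoStates i,
    ((t : ℝ) * (2 * U) ^ p * (((G.infoActions s).card : ℝ) - 1)
      + 2 * U * G.approxError p R' σ t s) ^ (1 / p)

/-- `τ` is a profile of average sequence weight policies of `σ 1, …, σ t`. -/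
def IsAverageProfile (σ : ℕ → ι → α → ℝ) (t : ℕ) (τ : ι → α → ℝ) : Prop :=
  G.IsProfile τ ∧ ∀ s, IsProportional (G.infoActions s) (τ s) (fun a =>
    ∑ k ∈ Finset.range t, ∑ h ∈ G.cell s,
      G.reach {some (G.owner s)} (σ (k + 1)) h * σ (k + 1) s a)

/-- `τ` is an `ε`-Nash equilibrium: no player gains more than `ε` by a unilateral deviation to
another policy. -/
def IsNash (ε : ℝ) (τ : ι → α → ℝ) : Prop :=
  ∀ i, ∀ τ', G.IsProfile τ' → G.value i (G.deviate i τ' τ) ≤ G.value i τ + ε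

end EFG

/-! A local regret bound at each information state is combined with a decomposition of the game's
regret.

Locally, the potential `∑ (R⁺) ^ p` changes in one round by at most its linear term plus the sum of
the `p`-th powers of the instantaneous regrets (`posPart_rpow_add_le`). A policy proportional to the
link of the estimate makes the estimate's own linear term vanish (`sum_mul_instRegret_eq_zero`), so
the true linear term is at most `2U` times the ℓ¹ error. The powers sum to at most `(2U)^p (|A| -
1)` (`sum_abs_sub_mean_rpow_le`). Summing over rounds and taking a `p`-th root bounds every
cumulative regret.

Globally, the gain of a deviation `τ` is a sum over the player's information states of `τ`'s own
reach probability times the `τ`-mean of the instantaneous regrets (`value_deviate_sub_value`). By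
perfect recall these coefficients are constant on each cell; they lie in `[0, 1]` and are the same
in every round, so the average regret is at most the sum of the local bounds.

Average policies realize the mean of the own reach probabilities, hence values against them are mean
values; adding both players' regrets cancels the value of play because the game is zero-sum. -/

/-! ### Inequalities for the polynomial potential -/

section PolynomialPotential

open Finset

variable {p : ℝ}

/-- Second order bound for `x ↦ x ^ p` under an increase of the argument. -/
lemma rpow_add_le_taylor (hp1 : 1 < p) (hp2 : p ≤ 2) {x y : ℝ} (hx : 0 ≤ x) (hy : 0 ≤ y) :
    (x + y) ^ p ≤ x ^ p + p * x ^ (p - 1) * y + y ^ p := by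
  let φ : ℝ → ℝ := fun y => x ^ p + p * x ^ (p - 1) * y + y ^ p - (x + y) ^ p
  have hd : ∀ y, HasDerivAt φ (p * x ^ (p - 1) * 1 + 1 * p * y ^ (p - 1)
      - 1 * p * (x + y) ^ (p - 1)) y := fun y =>
    ((((hasDerivAt_id y).const_mul _).const_add _).add
      ((hasDerivAt_id y).rpow_const (Or.inr hp1.le))).sub
      (((hasDerivAt_id y).const_add x).rpow_const (Or.inr hp1.le))
  -- `φ 0 = 0`, and `φ' ≥ 0` because the power `p - 1`, with exponent in `[0, 1]`, is subadditive.
  have hmono : MonotoneOn φ (Set.Ici 0) := by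
    refine monotoneOn_of_deriv_nonneg (convex_Ici 0)
      (fun y _ => (hd y).continuousAt.continuousWithinAt)
      (fun y _ => (hd y).differentiableAt.differentiableWithinAt) fun y hy => ?_
    rw [interior_Ici] at hy
    have h := Real.rpow_add_le_add_rpow hx (le_of_lt hy) (by linarith : 0 ≤ p - 1)
      (by linarith : p - 1 ≤ 1)
    rw [(hd y).deriv]
    nlinarith
  have h := hmono Set.self_mem_Ici hy hy
  simp only [φ, mul_zero, add_zero, Real.zero_rpow (by linarith : p ≠ 0)] at h
  linarith

/-- Second order bound for `x ↦ x ^ p` under a decrease of the argument. -/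
lemma rpow_sub_le_taylor (hp1 : 1 < p) (hp2 : p ≤ 2) {x y : ℝ} (hy : 0 ≤ y) (hyx : y ≤ x) :
    (x - y) ^ p ≤ x ^ p - p * x ^ (p - 1) * y + y ^ p := by
  let φ : ℝ → ℝ := fun y => x ^ p - p * x ^ (p - 1) * y + y ^ p - (x - y) ^ p
  have hd : ∀ y, HasDerivAt φ (-(p * x ^ (p - 1) * 1) + 1 * p * y ^ (p - 1)
      - (-1) * p * (x - y) ^ (p - 1)) y := fun y =>
    ((((hasDerivAt_id y).const_mul _).const_sub _).add
      ((hasDerivAt_id y).rpow_const (Or.inr hp1.le))).sub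
      (((hasDerivAt_id y).const_sub x).rpow_const (Or.inr hp1.le))
  have hmono : MonotoneOn φ (Set.Icc 0 x) := by
    refine monotoneOn_of_deriv_nonneg (convex_Icc 0 x)
      (fun y _ => (hd y).continuousAt.continuousWithinAt)
      (fun y _ => (hd y).differentiableAt.differentiableWithinAt) fun y hy => ?_
    rw [interior_Icc] at hy
    -- Subadditivity applied to the splitting `x = y + (x - y)`.
    have h := Real.rpow_add_le_add_rpow hy.1.le (sub_nonneg.2 hy.2.le) (by linarith : 0 ≤ p - 1)
      (by linarith : p - 1 ≤ 1)
    rw [add_sub_cancel] at h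
    rw [(hd y).deriv]
    nlinarith
  have h := hmono ⟨le_rfl, hy.trans hyx⟩ ⟨hy, hyx⟩ hy
  simp only [φ, mul_zero, sub_zero, add_zero, Real.zero_rpow (by linarith : p ≠ 0)] at h
  linarith

/-- Second order bound for the polynomial potential `x ↦ (x⁺) ^ p`. -/
lemma posPart_rpow_add_le (hp1 : 1 < p) (hp2 : p ≤ 2) (x y : ℝ) :
    max (x + y) 0 ^ p ≤ max x 0 ^ p + p * max x 0 ^ (p - 1) * y + |y| ^ p := by
  have hp0 : 0 ≤ p := by linarith
  rcases le_or_gt x 0 with hx | hx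
  · rw [max_eq_right hx, Real.zero_rpow (by linarith), Real.zero_rpow (by linarith)]
    have h : max (x + y) 0 ≤ |y| := max_le (by linarith [le_abs_self y]) (abs_nonneg y)
    have := Real.rpow_le_rpow (le_max_right _ _) h hp0
    linarith
  rw [max_eq_left hx.le]
  rcases le_or_gt 0 y with hy | hy
  · rw [max_eq_left (by linarith), abs_of_nonneg hy]
    exact rpow_add_le_taylor hp1 hp2 hx.le hy
  rw [abs_of_neg hy]
  rcases le_or_gt 0 (x + y) with hxy | hxy
  · rw [max_eq_left hxy]
    have := rpow_sub_le_taylor hp1 hp2 (x := x) (y := -y) (by linarith) (by linarith)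
    rw [sub_neg_eq_add] at this
    linarith
  · rw [max_eq_right hxy.le, Real.zero_rpow (by linarith)]
    -- Bernoulli for `(-y / x) ^ p`, scaled by `x ^ p`, leaves `(2 - p) * x ^ p` as a lower bound of
    -- the right-hand side; here `p ≤ 2` enters.
    have hb := one_add_mul_self_le_rpow_one_add (s := -y / x - 1)
      (by have : 0 ≤ -y / x := div_nonneg (by linarith) hx.le
          linarith) hp1.le
    rw [add_sub_cancel, Real.div_rpow (by linarith) hx.le, le_div_iff₀ (by positivity)] at hb
    have hxp : x ^ p = x ^ (p - 1) * x := by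
      rw [← Real.rpow_add_one hx.ne', sub_add_cancel]
    have hxp0 : 0 ≤ x ^ p := by positivity
    have e : (1 + p * (-y / x - 1)) * x ^ p = (1 - p) * x ^ p - p * x ^ (p - 1) * y := by
      rw [hxp]; field_simp; ring
    rw [e] at hb
    nlinarith

/-- The deviations of values in `[-U, U]` from a mean of theirs. -/
lemma sum_abs_sub_mean_rpow_le {α : Type*} (hp1 : 1 ≤ p) {A : Finset α} {q v : α → ℝ} {U : ℝ}
    (hq : ∀ a ∈ A, 0 ≤ q a) (hq1 : ∑ a ∈ A, q a = 1) (hv : ∀ a ∈ A, |v a| ≤ U) :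
    ∑ a ∈ A, |v a - ∑ b ∈ A, q b * v b| ^ p ≤ (2 * U) ^ p * ((A.card : ℝ) - 1) := by
  classical
  have hpair : ∀ a ∈ A, ∀ b ∈ A, |v a - v b| ≤ 2 * U := fun a ha b hb => by
    have := abs_sub (v a) (v b)
    linarith [hv a ha, hv b hb]
  have hjensen : ∀ a ∈ A, |v a - ∑ b ∈ A, q b * v b| ^ p ≤ ∑ b ∈ A, q b * |v a - v b| ^ p := by
    intro a _
    have h1 : v a - ∑ b ∈ A, q b * v b = ∑ b ∈ A, q b * (v a - v b) := by
      simp only [mul_sub, sum_sub_distrib, ← sum_mul, hq1, one_mul]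
    have h2 : |v a - ∑ b ∈ A, q b * v b| ≤ ∑ b ∈ A, q b * |v a - v b| := by
      rw [h1]
      refine (abs_sum_le_sum_abs _ _).trans_eq (sum_congr rfl fun b hb => ?_)
      rw [abs_mul, abs_of_nonneg (hq b hb)]
    refine (Real.rpow_le_rpow (abs_nonneg _) h2 (by linarith)).trans ?_
    exact Real.rpow_arith_mean_le_arith_mean_rpow A q _ hq hq1 (fun _ _ => abs_nonneg _) hp1
  refine (sum_le_sum hjensen).trans ?_
  rw [sum_comm]
  have hcol : ∀ b ∈ A, ∑ a ∈ A, q b * |v a - v b| ^ p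
      ≤ q b * ((2 * U) ^ p * ((A.card : ℝ) - 1)) := by
    intro b hb
    rw [← mul_sum, ← add_sum_erase A _ hb, sub_self, abs_zero, Real.zero_rpow (by linarith),
      zero_add]
    refine mul_le_mul_of_nonneg_left ?_ (hq b hb)
    refine (sum_le_card_nsmul _ _ ((2 * U) ^ p) fun a ha => Real.rpow_le_rpow (abs_nonneg _)
      (hpair a (mem_of_mem_erase ha) b hb) (by linarith)).trans_eq ?_
    rw [nsmul_eq_mul, card_erase_of_mem hb, Nat.cast_sub (card_pos.2 ⟨b, hb⟩), Nat.cast_one,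
      mul_comm]
  refine (sum_le_sum hcol).trans_eq ?_
  rw [← sum_mul, hq1, one_mul]

end PolynomialPotential

namespace EFG

open Finset

lemma polyLink_nonneg {α : Type*} (p : ℝ) (x : α → ℝ) (a : α) : 0 ≤ polyLink p x a :=
  Real.rpow_nonneg (le_max_right _ _) _

variable {α ι : Type*} [Fintype α] [Fintype ι] (G : EFG α ι)

/-! ### Factorization of reach probabilities -/

section Reach

variable {G} {C D : Set (Option (Fin 2))} {σ σ' : ι → α → ℝ}

lemma reachFrom_append (h l₁ l₂ : List α) :
    G.reachFrom C σ h (l₁ ++ l₂) = G.reachFrom C σ h l₁ * G.reachFrom C σ (h ++ l₁) l₂ := by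
  induction l₁ generalizing h with
  | nil => simp [reachFrom]
  | cons a l ih => simp [reachFrom, ih, mul_assoc]

open Classical in
lemma reach_concat (h : List α) (a : α) :
    G.reach C σ (h ++ [a]) =
      G.reach C σ h * if G.mover h ∈ C then G.stepProb σ h a else 1 := by
  simp [reach, reachFrom_append, reachFrom]

lemma reachFrom_union (hCD : Disjoint C D) (h l : List α) :
    G.reachFrom (C ∪ D) σ h l = G.reachFrom C σ h l * G.reachFrom D σ h l := by
  induction l generalizing h with
  | nil => simp [reachFrom]
  | cons a l ih =>
    simp only [reachFrom, ih]
    by_cases hC : G.mover h ∈ C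
    · have hD : G.mover h ∉ D := Set.disjoint_left.1 hCD hC
      simp only [Set.mem_union, hC, hD, true_or, if_true, if_false]; ring
    · by_cases hD : G.mover h ∈ D
      · simp only [Set.mem_union, hC, hD, or_true, if_true, if_false]; ring
      · simp only [Set.mem_union, hC, hD, or_self, if_false]; ring

lemma reachFrom_univ (h l : List α) :
    G.reachFrom Set.univ σ h l = G.reachFrom C σ h l * G.reachFrom Cᶜ σ h l := by
  rw [← reachFrom_union disjoint_compl_right, Set.union_compl_self]

lemma reachFrom_congr (hσ : ∀ s, some (G.owner s) ∈ C → σ s = σ' s) (h l : List α) :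
    G.reachFrom C σ h l = G.reachFrom C σ' h l := by
  induction l generalizing h with
  | nil => rfl
  | cons a l ih =>
    simp only [reachFrom, ih]
    congr 1
    split_ifs with hm
    · unfold stepProb
      unfold mover at hm
      cases ht : G.turn h with
      | none => rfl
      | some s => rw [ht] at hm; simp only; rw [hσ s hm]
    · rfl

/-- Only the player's own sequence enters its contribution; this is how perfect recall becomes a
statement about probabilities. -/
lemma reachFrom_own (i : Fin 2) (h l : List α) :
    G.reachFrom {some i} σ h l = ((G.ownSeq i h l).map fun x => σ x.1 x.2).prod := by
  induction l generalizing h with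
  | nil => simp [reachFrom, ownSeq]
  | cons a l ih =>
    simp only [reachFrom, ownSeq, ih]
    unfold mover stepProb
    cases ht : G.turn h with
    | none => simp
    | some s => by_cases hs : G.owner s = i <;> simp [hs]

lemma reach_own_eq (hG : G.PerfectRecall) {s : ι} {h h' : List α} (hh : h ∈ G.cell s)
    (hh' : h' ∈ G.cell s) :
    G.reach {some (G.owner s)} σ h = G.reach {some (G.owner s)} σ h' := by
  simp only [reach, reachFrom_own, hG s h hh h' hh']

lemma IsProfile.le_one (hσ : G.IsProfile σ) (s : ι) (a : α) : σ s a ≤ 1 := by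
  obtain ⟨h0, hout, h1⟩ := hσ s
  by_cases ha : a ∈ G.infoActions s
  · rw [← h1]
    exact single_le_sum (fun b _ => h0 b) ha
  · rw [hout a ha]; exact zero_le_one

lemma reach_own_mem_Icc (hσ : G.IsProfile σ) (i : Fin 2) (h : List α) :
    G.reach {some i} σ h ∈ Set.Icc 0 1 := by
  rw [reach, reachFrom_own]
  induction G.ownSeq i [] h with
  | nil => simp
  | cons x l ih =>
    rw [List.map_cons, List.prod_cons]
    exact ⟨mul_nonneg ((hσ x.1).1 x.2) ih.1, mul_le_one₀ (hσ.le_one _ _) ih.1 ih.2⟩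

lemma deviate_self (i : Fin 2) : G.deviate i σ σ = σ := by
  funext s
  simp [deviate]

end Reach

/-! ### The history tree and its information cells -/

section Histories

variable {G}

lemma mem_hist_of_append {h l : List α} (hl : h ++ l ∈ G.hist) : h ∈ G.hist := by
  induction l using List.reverseRecOn with
  | nil => simpa using hl
  | append_singleton l a ih => exact ih (G.prefix_mem _ a (by simpa using hl))

lemma mem_actions_of_append {h l : List α} {a : α} (hl : h ++ a :: l ∈ G.hist) :
    a ∈ G.actions h := by
  have h1 : h ++ [a] ∈ G.hist := mem_hist_of_append (l := l) (by simpa using hl)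
  exact (G.mem_actions h (G.prefix_mem _ _ h1) a).2 h1

lemma mem_terminals {z : List α} : z ∈ G.terminals ↔ z ∈ G.hist ∧ G.actions z = ∅ := by
  simp [terminals]

lemma mem_cell {s : ι} {h : List α} :
    h ∈ G.cell s ↔ h ∈ G.hist ∧ (G.actions h).Nonempty ∧ G.turn h = some s := by
  simp [cell]

lemma mem_infoStates {s : ι} {i : Fin 2} : s ∈ G.infoStates i ↔ G.owner s = i := by
  simp [infoStates]

lemma actions_of_mem_cell {s : ι} {h : List α} (hh : h ∈ G.cell s) :
    G.actions h = G.infoActions s :=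
  G.infoActions_eq h (mem_cell.1 hh).1 (mem_cell.1 hh).2.1 s (mem_cell.1 hh).2.2

lemma cell_nonempty (s : ι) : (G.cell s).Nonempty := by
  obtain ⟨h, h1, h2, h3⟩ := G.info_nonempty s
  exact ⟨h, mem_cell.2 ⟨h1, h2, h3⟩⟩

lemma infoActions_nonempty (s : ι) : (G.infoActions s).Nonempty := by
  obtain ⟨h, hh⟩ := G.cell_nonempty s
  rw [← actions_of_mem_cell hh]
  exact (mem_cell.1 hh).2.1

/-- Every history but the empty one is the successor of exactly one history. -/
lemma sum_hist_actions (F : List α → ℝ) :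
    ∑ h ∈ G.hist, ∑ a ∈ G.actions h, F (h ++ [a]) + F [] = ∑ h ∈ G.hist, F h := by
  classical
  rw [← sum_erase_add _ F G.nil_mem, sum_sigma']
  congr 1
  refine sum_bij (fun (x : (_ : List α) × α) _ => x.1 ++ [x.2]) ?_ ?_ ?_ fun _ _ => rfl
  · rintro ⟨h, a⟩ hx
    rw [mem_sigma] at hx
    simpa using (G.mem_actions h hx.1 a).1 hx.2
  · rintro ⟨h, a⟩ _ ⟨h', a'⟩ _ e
    have := List.append_inj' e rfl
    simp only [List.cons.injEq, and_true] at this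
    obtain ⟨rfl, rfl⟩ := this
    rfl
  · intro h hh
    rw [mem_erase] at hh
    rcases List.eq_nil_or_concat h with rfl | ⟨l, a, rfl⟩
    · exact absurd rfl hh.1
    · rw [List.concat_eq_append] at hh ⊢
      have hl := G.prefix_mem l a hh.2
      exact ⟨⟨l, a⟩, mem_sigma.2 ⟨hl, (G.mem_actions l hl a).2 hh.2⟩, rfl⟩

lemma sum_infoStates_cell (i : Fin 2) (F : List α → ℝ)
    (hF : ∀ h ∈ G.hist, (G.actions h).Nonempty → G.mover h ≠ some i → F h = 0)
    (hF' : ∀ h ∈ G.hist, G.actions h = ∅ → F h = 0) :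
    ∑ h ∈ G.hist, F h = ∑ s ∈ G.infoStates i, ∑ h ∈ G.cell s, F h := by
  classical
  rw [← sum_biUnion]
  · symm
    refine sum_subset ?_ ?_
    · intro h hh
      obtain ⟨s, _, hs⟩ := mem_biUnion.1 hh
      exact (mem_cell.1 hs).1
    · intro h hh hn
      rcases (G.actions h).eq_empty_or_nonempty with he | he
      · exact hF' h hh he
      · refine hF h hh he fun hm => hn ?_
        unfold mover at hm
        obtain ⟨s, hs, hsi⟩ := Option.map_eq_some_iff.1 hm
        exact mem_biUnion.2 ⟨s, mem_infoStates.2 hsi, mem_cell.2 ⟨hh, he, hs⟩⟩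
  · intro s _ s' _ hne
    refine disjoint_left.2 fun h hs hs' => hne ?_
    exact Option.some.inj ((mem_cell.1 hs).2.2.symm.trans (mem_cell.1 hs').2.2)

end Histories

/-! ### Continuation values and the decomposition of a deviation's gain -/

section HistValue

variable {G} {σ ρ : ι → α → ℝ}

variable (G) in
/-- The expected value to player `i` of continuing from `h` under `σ`. -/
noncomputable def histValue (i : Fin 2) (σ : ι → α → ℝ) (h : List α) : ℝ :=
  ∑ z ∈ G.terminals, G.reachBetween Set.univ σ h z * G.util i z

lemma histValue_nil (i : Fin 2) : G.histValue i σ [] = G.value i σ := by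
  simp [histValue, value, reachBetween, reach]

lemma histValue_terminal (i : Fin 2) {z : List α} (hz : z ∈ G.terminals) :
    G.histValue i σ z = G.util i z := by
  unfold histValue
  rw [sum_eq_single_of_mem z hz]
  · simp [reachBetween, reachFrom]
  · intro z' hz' hne
    rw [reachBetween, if_neg, zero_mul]
    rintro ⟨l, rfl⟩
    cases l with
    | nil => simp at hne
    | cons a l =>
      have := mem_actions_of_append (mem_terminals.1 hz').1
      simp [(mem_terminals.1 hz).2] at this

lemma reachBetween_step {h z : List α} (hh : (G.actions h).Nonempty) (hz : z ∈ G.terminals) :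
    G.reachBetween Set.univ σ h z =
      ∑ a ∈ G.actions h, G.stepProb σ h a * G.reachBetween Set.univ σ (h ++ [a]) z := by
  by_cases hp : h <+: z
  · obtain ⟨l, rfl⟩ := hp
    cases l with
    | nil =>
      rw [List.append_nil] at hz
      exact absurd (mem_terminals.1 hz).2 hh.ne_empty
    | cons b l =>
      have hb := mem_actions_of_append (mem_terminals.1 hz).1
      have e : h ++ b :: l = (h ++ [b]) ++ l := by simp
      rw [sum_eq_single_of_mem b hb]
      · rw [reachBetween, if_pos (List.prefix_append _ _), reachBetween,
          if_pos (e ▸ List.prefix_append _ _), List.drop_left]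
        rw [e, List.drop_left]
        simp [reachFrom]
      · intro a _ hab
        rw [reachBetween, if_neg, mul_zero]
        rintro ⟨l', hl'⟩
        simp only [List.append_assoc, List.cons_append, List.nil_append,
          List.append_cancel_left_eq, List.cons.injEq] at hl'
        exact hab hl'.1
  · rw [reachBetween, if_neg hp, sum_eq_zero]
    intro a _
    rw [reachBetween, if_neg, mul_zero]
    exact fun h' => hp ((List.prefix_append h [a]).trans h')

lemma histValue_step (i : Fin 2) {h : List α} (hh : (G.actions h).Nonempty) :
    G.histValue i σ h =
      ∑ a ∈ G.actions h, G.stepProb σ h a * G.histValue i σ (h ++ [a]) := by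
  simp only [histValue, mul_sum]
  rw [sum_comm]
  refine sum_congr rfl fun z hz => ?_
  rw [reachBetween_step hh hz, sum_mul]
  exact sum_congr rfl fun a _ => mul_assoc _ _ _

/-- The performance difference identity. -/
lemma value_sub_value (i : Fin 2) :
    G.value i ρ - G.value i σ = ∑ h ∈ G.hist, ∑ a ∈ G.actions h,
      G.reach Set.univ ρ h * (G.stepProb ρ h a - G.stepProb σ h a) *
        G.histValue i σ (h ++ [a]) := by
  classical
  have h1 := G.sum_hist_actions fun h => G.reach Set.univ ρ h * G.histValue i σ h
  -- Both identities evaluate the `ρ`-weighted sum of `σ`-values: `h1` through predecessors in the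
  -- tree, `h2` through one step of `σ` at non-terminal histories, with terminal ones giving `value
  -- i ρ`.
  have h2 : ∑ h ∈ G.hist, ∑ a ∈ G.actions h,
      G.reach Set.univ ρ h * G.stepProb σ h a * G.histValue i σ (h ++ [a]) + G.value i ρ =
      ∑ h ∈ G.hist, G.reach Set.univ ρ h * G.histValue i σ h := by
    have hv : G.value i ρ = ∑ h ∈ G.hist,
        if G.actions h = ∅ then G.reach Set.univ ρ h * G.histValue i σ h else 0 := by
      rw [value, ← sum_filter]
      refine sum_congr (by ext z; simp [mem_terminals]) fun z hz => ?_
      rw [histValue_terminal i]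
      simpa [mem_terminals] using hz
    rw [hv, ← sum_add_distrib]
    refine sum_congr rfl fun h _ => ?_
    split_ifs with he
    · simp [he]
    · rw [histValue_step i (nonempty_iff_ne_empty.2 he), mul_sum, add_zero]
      exact sum_congr rfl fun a _ => mul_assoc _ _ _
  have h3 : G.reach Set.univ ρ [] = 1 := rfl
  simp only [reach_concat, Set.mem_univ, if_true, h3, one_mul, histValue_nil] at h1
  simp only [mul_sub, sub_mul, sum_sub_distrib]
  linarith

/-- The owner moves at `h`, so playing `a` leaves the others' contribution unchanged; after `h ++
[a]` both contributions multiply to the full one. -/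
lemma cfValue_eq (s : ι) (a : α) :
    G.cfValue σ s a = ∑ h ∈ G.cell s,
      G.reach {some (G.owner s)}ᶜ σ h * G.histValue (G.owner s) σ (h ++ [a]) := by
  refine sum_congr rfl fun h hh => ?_
  rw [histValue, mul_sum]
  refine sum_congr rfl fun z _ => ?_
  simp only [reachBetween]
  split_ifs with hp
  · obtain ⟨l, rfl⟩ := hp
    have hm : G.mover h = some (G.owner s) := by simp [mover, (mem_cell.1 hh).2.2]
    have e : G.reach {some (G.owner s)}ᶜ σ (h ++ [a] ++ l) =
        G.reach {some (G.owner s)}ᶜ σ h *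
          G.reachFrom {some (G.owner s)}ᶜ σ (h ++ [a]) l := by
      rw [reach, reachFrom_append, List.nil_append]
      change G.reach _ σ (h ++ [a]) * _ = _
      simp [reach_concat, hm]
    rw [e, List.drop_left, reachFrom_univ (C := {some (G.owner s)})]
    ring
  · simp

/-- The gain of a deviation is a combination of the instantaneous counterfactual regrets. -/
lemma value_deviate_sub_value {τ : ι → α → ℝ} (hτ : G.IsProfile τ) (i : Fin 2) {c : ι → ℝ}
    (hc : ∀ s, ∀ h ∈ G.cell s, G.reach {some (G.owner s)} τ h = c s) :
    G.value i (G.deviate i τ σ) - G.value i σ =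
      ∑ s ∈ G.infoStates i, c s * ∑ a ∈ G.infoActions s, τ s a * G.instRegret σ s a := by
  rw [value_sub_value, sum_infoStates_cell i]
  · refine sum_congr rfl fun s hs => ?_
    obtain rfl := mem_infoStates.1 hs
    have hinst : ∑ a ∈ G.infoActions s, τ s a * G.instRegret σ s a =
        ∑ a ∈ G.infoActions s, (τ s a - σ s a) * G.cfValue σ s a := by
      simp only [instRegret, mul_sub, sub_mul, sum_sub_distrib, ← sum_mul, (hτ s).2.2, one_mul]
    rw [hinst]
    simp only [cfValue_eq, mul_sum]
    conv_rhs => rw [sum_comm]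
    refine sum_congr rfl fun h hh => ?_
    rw [actions_of_mem_cell hh]
    refine sum_congr rfl fun a _ => ?_
    have hr : G.reach Set.univ (G.deviate (G.owner s) τ σ) h =
        c s * G.reach {some (G.owner s)}ᶜ σ h := by
      rw [← hc s h hh, reach, reachFrom_univ (C := {some (G.owner s)})]
      congr 1
      · refine reachFrom_congr (fun s' hs' => ?_) _ _
        simp only [Set.mem_singleton_iff, Option.some.injEq] at hs'
        simp [deviate, hs']
      · refine reachFrom_congr (fun s' hs' => ?_) _ _
        simp only [Set.mem_compl_iff, Set.mem_singleton_iff, Option.some.injEq] at hs'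
        simp [deviate, hs']
    rw [hr]
    simp only [stepProb, (mem_cell.1 hh).2.2, deviate, if_true]
    ring
  · intro h _ _ hm
    refine sum_eq_zero fun a _ => ?_
    have : G.stepProb (G.deviate i τ σ) h a = G.stepProb σ h a := by
      unfold stepProb
      unfold mover at hm
      cases ht : G.turn h with
      | none => rfl
      | some s =>
        have hs : G.owner s ≠ i := by simpa [ht] using hm
        simp [deviate, hs]
    rw [this, sub_self, mul_zero, zero_mul]
  · intro h _ he
    rw [he, sum_empty]

end HistValue

/-! ### Regret bounds for approximate regret matching -/

section Regret

variable {G} {p U : ℝ} {R' : ℕ → ι → α → ℝ} {σ : ℕ → ι → α → ℝ} {t : ℕ}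

lemma cumRegret_succ (k : ℕ) (s : ι) (a : α) :
    G.cumRegret σ (k + 1) s a = G.cumRegret σ k s a + G.instRegret (σ (k + 1)) s a :=
  sum_range_succ _ _

lemma abs_instRegret_le (hU : G.BoundsRewards U) {ρ : ι → α → ℝ} (hρ : G.IsProfile ρ) {s : ι}
    {a : α} (ha : a ∈ G.infoActions s) : |G.instRegret ρ s a| ≤ 2 * U := by
  have hmean : |∑ b ∈ G.infoActions s, ρ s b * G.cfValue ρ s b| ≤ U := by
    refine (abs_sum_le_sum_abs _ _).trans ?_
    calc ∑ b ∈ G.infoActions s, |ρ s b * G.cfValue ρ s b|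
        ≤ ∑ b ∈ G.infoActions s, ρ s b * U := sum_le_sum fun b hb => by
          rw [abs_mul, abs_of_nonneg ((hρ s).1 b)]
          exact mul_le_mul_of_nonneg_left (hU ρ hρ s b hb) ((hρ s).1 b)
      _ = U := by rw [← sum_mul, (hρ s).2.2, one_mul]
  have := abs_sub (G.cfValue ρ s a) (∑ b ∈ G.infoActions s, ρ s b * G.cfValue ρ s b)
  unfold instRegret
  linarith [hU ρ hρ s a ha]

/-- Regret matching is orthogonal to the regret it produces. -/
lemma sum_mul_instRegret_eq_zero {ρ : ι → α → ℝ} (hρ : G.IsProfile ρ) {s : ι} {w : α → ℝ}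
    (hw : ∀ a, 0 ≤ w a) (hprop : IsProportional (G.infoActions s) (ρ s) w) :
    ∑ a ∈ G.infoActions s, w a * G.instRegret ρ s a = 0 := by
  -- Nonnegative weights with zero sum all vanish, so an arbitrary policy does no harm here.
  by_cases h0 : ∑ b ∈ G.infoActions s, w b = 0
  · refine sum_eq_zero fun a ha => ?_
    rw [(sum_eq_zero_iff_of_nonneg fun b _ => hw b).1 h0 a ha, zero_mul]
  · have hq : ∀ a ∈ G.infoActions s, w a = (∑ b ∈ G.infoActions s, w b) * ρ s a := by
      intro a ha
      rw [hprop h0 a ha]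
      field_simp
    calc ∑ a ∈ G.infoActions s, w a * G.instRegret ρ s a
        = ∑ a ∈ G.infoActions s, (∑ b ∈ G.infoActions s, w b) * (ρ s a * G.instRegret ρ s a) :=
          sum_congr rfl fun a ha => by rw [hq a ha, mul_assoc]
      _ = 0 := by
          simp only [← mul_sum, instRegret, mul_sub, sum_sub_distrib, ← sum_mul, (hρ s).2.2,
            one_mul, sub_self]

lemma bound_nonneg (hU : G.BoundsRewards U) {ρ : ι → α → ℝ} (hρ : G.IsProfile ρ) (s : ι) :
    0 ≤ U := by
  obtain ⟨a, ha⟩ := G.infoActions_nonempty s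
  exact (abs_nonneg _).trans (hU ρ hρ s a ha)

lemma approxError_nonneg (s : ι) : 0 ≤ G.approxError p R' σ t s :=
  sum_nonneg fun _ _ => sum_nonneg fun _ _ => abs_nonneg _

lemma one_le_card_infoActions (s : ι) : (1 : ℝ) ≤ (G.infoActions s).card := by
  exact_mod_cast card_pos.2 (G.infoActions_nonempty s)

lemma sum_cumRegret_rpow_le (hp1 : 1 < p) (hp2 : p ≤ 2) (hU : G.BoundsRewards U)
    (hσ : G.IsRCFR (polyLink p) R' t σ) (s : ι) :
    ∑ a ∈ G.infoActions s, max (G.cumRegret σ t s a) 0 ^ p ≤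
      t * (2 * U) ^ p * (((G.infoActions s).card : ℝ) - 1)
        + 2 * U * G.approxError p R' σ t s := by
  suffices H : ∀ n ≤ t, ∑ a ∈ G.infoActions s, max (G.cumRegret σ n s a) 0 ^ p ≤
      n * (2 * U) ^ p * (((G.infoActions s).card : ℝ) - 1)
        + 2 * U * G.approxError p R' σ n s from H t le_rfl
  intro n
  induction n with
  | zero =>
    intro _
    simp [cumRegret, approxError, Real.zero_rpow (by linarith : p ≠ 0)]
  | succ n ih =>
    intro hn
    obtain ⟨hρ, hprop⟩ := hσ n hn
    have hstep : ∑ a ∈ G.infoActions s, max (G.cumRegret σ (n + 1) s a) 0 ^ p ≤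
        ∑ a ∈ G.infoActions s, max (G.cumRegret σ n s a) 0 ^ p
        + ∑ a ∈ G.infoActions s,
          p * polyLink p (G.cumRegret σ n s) a * G.instRegret (σ (n + 1)) s a
        + ∑ a ∈ G.infoActions s, |G.instRegret (σ (n + 1)) s a| ^ p := by
      rw [← sum_add_distrib, ← sum_add_distrib]
      refine sum_le_sum fun a _ => ?_
      rw [cumRegret_succ]
      exact posPart_rpow_add_le hp1 hp2 _ _
    have hsq : ∑ a ∈ G.infoActions s, |G.instRegret (σ (n + 1)) s a| ^ p ≤
        (2 * U) ^ p * (((G.infoActions s).card : ℝ) - 1) :=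
      sum_abs_sub_mean_rpow_le hp1.le (fun a _ => (hρ s).1 a) (hρ s).2.2 (hU _ hρ s)
    have hlin : ∑ a ∈ G.infoActions s,
          p * polyLink p (G.cumRegret σ n s) a * G.instRegret (σ (n + 1)) s a ≤
        2 * U * ∑ a ∈ G.infoActions s,
          |p * polyLink p (G.cumRegret σ n s) a - p * polyLink p (R' n s) a| := by
      -- Subtracting the estimate's link costs nothing, so only the error is paired with the regret.
      have h0 := sum_mul_instRegret_eq_zero hρ (polyLink_nonneg p _) (hprop s)
      calc ∑ a ∈ G.infoActions s,
            p * polyLink p (G.cumRegret σ n s) a * G.instRegret (σ (n + 1)) s a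
          = ∑ a ∈ G.infoActions s,
              (p * polyLink p (G.cumRegret σ n s) a - p * polyLink p (R' n s) a)
                * G.instRegret (σ (n + 1)) s a := by
            simp only [sub_mul, sum_sub_distrib, mul_assoc p, ← mul_sum, h0, mul_zero, sub_zero]
        _ ≤ _ := by
            rw [mul_sum]
            refine sum_le_sum fun a ha => (le_abs_self _).trans ?_
            rw [abs_mul, mul_comm]
            exact mul_le_mul_of_nonneg_right (abs_instRegret_le hU hρ ha) (abs_nonneg _)
    have herr : G.approxError p R' σ (n + 1) s = G.approxError p R' σ n s +
        ∑ a ∈ G.infoActions s,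
          |p * polyLink p (G.cumRegret σ n s) a - p * polyLink p (R' n s) a| :=
      sum_range_succ _ _
    rw [herr]
    push_cast
    linarith [ih (by omega)]

lemma regretBase_nonneg (p : ℝ) (hU : 0 ≤ U) (s : ι) :
    0 ≤ t * (2 * U) ^ p * (((G.infoActions s).card : ℝ) - 1)
      + 2 * U * G.approxError p R' σ t s := by
  have h1 := sub_nonneg.2 (G.one_le_card_infoActions s)
  have h2 : 0 ≤ G.approxError p R' σ t s := approxError_nonneg s
  positivity

lemma cumRegret_le (hp1 : 1 < p) (hp2 : p ≤ 2) (hU : G.BoundsRewards U)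
    (hσ : G.IsRCFR (polyLink p) R' t σ) {s : ι} {a : α} (ha : a ∈ G.infoActions s) :
    G.cumRegret σ t s a ≤ (t * (2 * U) ^ p * (((G.infoActions s).card : ℝ) - 1)
        + 2 * U * G.approxError p R' σ t s) ^ (1 / p) := by
  have h0 : ∀ b, 0 ≤ max (G.cumRegret σ t s b) 0 := fun b => le_max_right _ _
  have h1 := (single_le_sum (fun b _ => Real.rpow_nonneg (h0 b) p) ha).trans
    (sum_cumRegret_rpow_le hp1 hp2 hU hσ s)
  have h2 := Real.rpow_le_rpow (Real.rpow_nonneg (h0 a) p) h1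
    (by positivity : 0 ≤ 1 / p)
  rw [← Real.rpow_mul (h0 a), mul_one_div_cancel (by linarith), Real.rpow_one] at h2
  exact (le_max_left _ _).trans h2

/-- The regret for not having followed any behavioral policy. -/
lemma sum_value_deviate_sub_le (hG : G.PerfectRecall) (hp1 : 1 < p) (hp2 : p ≤ 2)
    (hU : G.BoundsRewards U) (ht : 0 < t) (hσ : G.IsRCFR (polyLink p) R' t σ)
    {τ : ι → α → ℝ} (hτ : G.IsProfile τ) (i : Fin 2) :
    1 / (t : ℝ) * ∑ k ∈ range t,
      (G.value i (G.deviate i τ (σ (k + 1))) - G.value i (σ (k + 1))) ≤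
      G.regretBound p U R' σ t i := by
  refine mul_le_mul_of_nonneg_left ?_ (by positivity)
  choose h₀ hh₀ using G.cell_nonempty
  have hc : ∀ s, ∀ h ∈ G.cell s, G.reach {some (G.owner s)} τ h =
      G.reach {some (G.owner s)} τ (h₀ s) := fun s h hh => reach_own_eq hG hh (hh₀ s)
  simp only [value_deviate_sub_value hτ i hc]
  rw [sum_comm]
  refine sum_le_sum fun s _ => ?_
  have hU0 : 0 ≤ U := bound_nonneg hU (hσ 0 ht).1 s
  set B := (t * (2 * U) ^ p * (((G.infoActions s).card : ℝ) - 1)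
        + 2 * U * G.approxError p R' σ t s) ^ (1 / p)
  have hB0 : 0 ≤ B := Real.rpow_nonneg (regretBase_nonneg p hU0 s) _
  obtain ⟨hc0, hc1⟩ := reach_own_mem_Icc hτ (G.owner s) (h₀ s)
  rw [← mul_sum, sum_comm]
  have hle : ∑ a ∈ G.infoActions s, ∑ k ∈ range t, τ s a * G.instRegret (σ (k + 1)) s a ≤ B := by
    calc _ ≤ ∑ a ∈ G.infoActions s, τ s a * B := sum_le_sum fun a ha => by
          rw [← mul_sum]
          exact mul_le_mul_of_nonneg_left (cumRegret_le hp1 hp2 hU hσ ha) ((hτ s).1 a)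
      _ = B := by rw [← sum_mul, (hτ s).2.2, one_mul]
  calc _ ≤ G.reach {some (G.owner s)} τ (h₀ s) * B := mul_le_mul_of_nonneg_left hle hc0
    _ ≤ B := mul_le_of_le_one_left hB0 hc1

lemma isProfile_playPure {ρ : ι → α → ℝ} (hρ : G.IsProfile ρ) (i : Fin 2)
    (b : G.PureStrategy i) : G.IsProfile (G.playPure i b ρ) := by
  classical
  intro s
  by_cases hs : G.owner s = i
  · have hb := (b ⟨s, hs⟩).2
    refine ⟨fun a => ?_, fun a ha => ?_, ?_⟩
    · simp only [playPure, hs, dite_true]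
      split_ifs <;> norm_num
    · simp only [playPure, hs, dite_true]
      rw [if_neg]
      rintro rfl
      exact ha hb
    · simp [playPure, hs]
  · simpa [playPure, hs] using hρ s

lemma nonempty_pureStrategy (i : Fin 2) : Nonempty (G.PureStrategy i) :=
  ⟨fun s => ⟨(G.infoActions_nonempty s).choose, (G.infoActions_nonempty s).choose_spec⟩⟩

/-- A pure strategy is played alike against all opponents. -/
lemma playPure_eq_deviate (i : Fin 2) (b : G.PureStrategy i) (ρ ρ' : ι → α → ℝ) :
    G.playPure i b ρ = G.deviate i (G.playPure i b ρ') ρ := by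
  funext s a
  by_cases hs : G.owner s = i <;> simp [playPure, deviate, hs]

lemma extRegret_le (hG : G.PerfectRecall) (hp1 : 1 < p) (hp2 : p ≤ 2)
    (hU : G.BoundsRewards U) (ht : 0 < t) (hσ : G.IsRCFR (polyLink p) R' t σ) (i : Fin 2) :
    1 / (t : ℝ) * G.extRegret σ t i ≤ G.regretBound p U R' σ t i := by
  have ht' : (0 : ℝ) < t := by exact_mod_cast ht
  rw [one_div, inv_mul_le_iff₀ ht']
  have := nonempty_pureStrategy (G := G) i
  refine ciSup_le fun b => ?_
  rw [← inv_mul_le_iff₀ ht', ← one_div]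
  -- The first profile merely fills in the opponent's information states, which `deviate` then
  -- discards.
  have h := sum_value_deviate_sub_le hG hp1 hp2 hU ht hσ
    (isProfile_playPure (hσ 0 ht).1 i b) i
  simpa only [← playPure_eq_deviate] using h

lemma regretBound_le (hp1 : 1 < p) (hU : G.BoundsRewards U) (ht : 0 < t)
    (hσ : G.IsRCFR (polyLink p) R' t σ) (i : Fin 2) :
    G.regretBound p U R' σ t i ≤ 1 / (t : ℝ) * (((G.infoStates i).card : ℝ) *
        ((t : ℝ) * (2 * U) ^ p * ((Fintype.card α : ℝ) - 1)
          + 2 * U * G.maxApproxError p R' σ t i) ^ (1 / p)) := by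
  refine mul_le_mul_of_nonneg_left ?_ (by positivity)
  refine (sum_le_card_nsmul _ _ _ fun s hs => ?_).trans_eq (nsmul_eq_mul _ _)
  have hU0 : 0 ≤ U := bound_nonneg hU (hσ 0 ht).1 s
  refine Real.rpow_le_rpow (regretBase_nonneg p hU0 s) ?_ (by positivity)
  have hcard : ((G.infoActions s).card : ℝ) ≤ Fintype.card α := by
    exact_mod_cast card_le_univ _
  have herr : G.approxError p R' σ t s ≤ G.maxApproxError p R' σ t i :=
    le_ciSup (f := fun s : {s : ι // G.owner s = i} => G.approxError p R' σ t s)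
      (Set.finite_range _).bddAbove ⟨s, mem_infoStates.1 hs⟩
  gcongr

end Regret

/-! ### Average policies and equilibrium -/

section Average

variable {G} {σ : ℕ → ι → α → ℝ} {t : ℕ} {τ : ι → α → ℝ}

/-- The average policies realize the average of the reach probabilities. -/
lemma reach_average (hG : G.PerfectRecall) (ht : 0 < t) (hσ : ∀ k < t, G.IsProfile (σ (k + 1)))
    (hτ : G.IsAverageProfile σ t τ) (i : Fin 2) {h : List α} (hh : h ∈ G.hist) :
    G.reach {some i} τ h = 1 / (t : ℝ) * ∑ k ∈ range t, G.reach {some i} (σ (k + 1)) h := by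
  have ht' : (t : ℝ) ≠ 0 := by exact_mod_cast ht.ne'
  induction h using List.reverseRecOn with
  | nil => simp [reach, reachFrom, ht']
  | append_singleton h a ih =>
    have hh' := G.prefix_mem h a hh
    have ha := (G.mem_actions h hh' a).2 hh
    have ih := ih hh'
    simp only [reach_concat, Set.mem_singleton_iff]
    by_cases hm : G.mover h = some i
    · simp only [hm, if_true]
      obtain ⟨s, hs, rfl⟩ := Option.map_eq_some_iff.1 hm
      have hcell : h ∈ G.cell s := mem_cell.2 ⟨hh', ⟨a, ha⟩, hs⟩
      simp only [stepProb, hs]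
      set π : ℕ → ℝ := fun k => G.reach {some (G.owner s)} (σ (k + 1)) h
      -- By perfect recall the sum over the cell is a factor `|cell|`, which cancels on normalizing.
      have hw : ∀ b, ∑ k ∈ range t, ∑ h' ∈ G.cell s,
          G.reach {some (G.owner s)} (σ (k + 1)) h' * σ (k + 1) s b =
          (G.cell s).card * ∑ k ∈ range t, π k * σ (k + 1) s b := by
        intro b
        rw [mul_sum]
        refine sum_congr rfl fun k _ => ?_
        rw [sum_congr rfl fun h' hh' => by rw [reach_own_eq hG hh' hcell], sum_const,
          nsmul_eq_mul]
      have hcard : ((G.cell s).card : ℝ) ≠ 0 := by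
        exact_mod_cast (card_pos.2 (G.cell_nonempty s)).ne'
      have hsum : ∑ b ∈ G.infoActions s, ∑ k ∈ range t, π k * σ (k + 1) s b =
          ∑ k ∈ range t, π k := by
        rw [sum_comm]
        refine sum_congr rfl fun k hk => ?_
        rw [← mul_sum, (hσ k (mem_range.1 hk) s).2.2, mul_one]
      have hprop := hτ.2 s
      unfold IsProportional at hprop
      simp only [hw, ← mul_sum, hsum] at hprop
      change _ = 1 / (t : ℝ) * ∑ k ∈ range t, π k * σ (k + 1) s a
      rw [ih]
      -- If no round's own policy reaches `s`, both sides vanish whatever `τ` does there.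
      by_cases h0 : ∑ k ∈ range t, π k = 0
      · have hz := (sum_eq_zero_iff_of_nonneg fun k hk =>
          (reach_own_mem_Icc (hσ k (mem_range.1 hk)) (G.owner s) h).1).1 h0
        rw [sum_eq_zero fun k hk => show π k * σ (k + 1) s a = 0 from
          mul_eq_zero_of_left (hz k hk) _]
        change 1 / (t : ℝ) * (∑ k ∈ range t, π k) * _ = _
        rw [h0]; ring
      · rw [hprop (mul_ne_zero hcard h0) a (actions_of_mem_cell hcell ▸ ha)]
        change 1 / (t : ℝ) * (∑ k ∈ range t, π k) * _ = _
        field_simp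
    · simpa [hm] using ih

lemma reach_deviate {i j : Fin 2} (hij : i ≠ j) (x y : ι → α → ℝ) (h : List α) :
    G.reach Set.univ (G.deviate i x y) h =
      G.reach {some i} x h * G.reach {none} y h * G.reach {some j} y h := by
  have hu : (Set.univ : Set (Option (Fin 2))) = {some i} ∪ ({none} ∪ {some j}) := by
    symm
    rw [Set.eq_univ_iff_forall]
    rintro (_ | k)
    · simp
    · have : k = i ∨ k = j := by omega
      rcases this with rfl | rfl <;> simp
  have hd1 : Disjoint ({some i} : Set (Option (Fin 2))) ({none} ∪ {some j}) := by simp [hij]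
  have hd2 : Disjoint ({none} : Set (Option (Fin 2))) {some j} := by simp
  rw [reach, hu, reachFrom_union hd1, reachFrom_union hd2, ← mul_assoc]
  refine congrArg₂ _ (congrArg₂ _ ?_ ?_) ?_ <;> refine reachFrom_congr (fun s hs => ?_) _ _
  · simp only [Set.mem_singleton_iff, Option.some.injEq] at hs
    simp [deviate, hs]
  · simp at hs
  · simp only [Set.mem_singleton_iff, Option.some.injEq] at hs
    simp [deviate, hs, hij.symm]

/-- Playing against the average policy yields the average value. -/
lemma value_deviate_average (hG : G.PerfectRecall) (ht : 0 < t)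
    (hσ : ∀ k < t, G.IsProfile (σ (k + 1))) (hτ : G.IsAverageProfile σ t τ) (i l : Fin 2)
    (x : ι → α → ℝ) :
    G.value l (G.deviate i x τ) =
      1 / (t : ℝ) * ∑ k ∈ range t, G.value l (G.deviate i x (σ (k + 1))) := by
  obtain ⟨j, hij⟩ : ∃ j, i ≠ j := ⟨1 - i, by omega⟩
  have hnone : ∀ (y y' : ι → α → ℝ) h, G.reach {none} y h = G.reach {none} y' h :=
    fun y y' h => reachFrom_congr (fun s hs => by simp at hs) _ _
  simp only [value]
  rw [sum_comm, mul_sum]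
  refine sum_congr rfl fun z hz => ?_
  simp only [reach_deviate hij, hnone _ τ, ← sum_mul, ← mul_sum,
    reach_average hG ht hσ hτ j (mem_terminals.1 hz).1]
  ring

lemma value_eq_neg {i j : Fin 2} (hij : i ≠ j) (x : ι → α → ℝ) :
    G.value i x = -G.value j x := by
  simp only [value, ← sum_neg_distrib]
  refine sum_congr rfl fun z _ => ?_
  have : (i = 0 ∧ j = 1) ∨ (i = 1 ∧ j = 0) := by omega
  rcases this with ⟨rfl, rfl⟩ | ⟨rfl, rfl⟩ <;> simp [util]

/-- Average regrets bound the exploitability of the average profile. -/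
lemma value_deviate_average_le (hG : G.PerfectRecall) (ht : 0 < t)
    (hσ : ∀ k < t, G.IsProfile (σ (k + 1))) (hτ : G.IsAverageProfile σ t τ) {ε : Fin 2 → ℝ}
    (hε : ∀ i x, G.IsProfile x → 1 / (t : ℝ) * ∑ k ∈ range t,
      (G.value i (G.deviate i x (σ (k + 1))) - G.value i (σ (k + 1))) ≤ ε i)
    {i j : Fin 2} (hij : i ≠ j) {x : ι → α → ℝ} (hx : G.IsProfile x) :
    G.value i (G.deviate i x τ) ≤ G.value i τ + (ε i + ε j) := by
  have h1 := hε i x hx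
  -- The opponent's deviation is to its own average policy, so the first term becomes `value j τ`.
  have h2 := hε j τ hτ.1
  rw [sum_sub_distrib, mul_sub, ← value_deviate_average hG ht hσ hτ] at h1 h2
  rw [deviate_self] at h2
  simp only [value_eq_neg hij.symm, sum_neg_distrib] at h2
  linarith

end Average

/-! ### Comparison with the earlier bound for `p = 2` -/

section Comparison

variable {G} {U : ℝ} {R' : ℕ → ι → α → ℝ} {σ : ℕ → ι → α → ℝ} {t : ℕ}

/-- The slack `t * (2 * U) ^ 2` on the left, positive when `U > 0` and `t > 0`, yields the strict
inequality. -/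
lemma regretBase_two_le (hU : 0 ≤ U) (s : ι) :
    (t : ℝ) * (2 * U) ^ (2 : ℝ) * (((G.infoActions s).card : ℝ) - 1)
        + 2 * U * G.approxError 2 R' σ t s + t * (2 * U) ^ 2 ≤
      (t : ℝ) * (2 * U) ^ 2 * ((G.infoActions s).card : ℝ)
        + 2 * U * √((G.infoActions s).card : ℝ) * G.approxError 2 R' σ t s := by
  have h1 : 1 ≤ √((G.infoActions s).card : ℝ) := Real.one_le_sqrt.2 (G.one_le_card_infoActions s)
  have h2 : 0 ≤ 2 * U * G.approxError 2 R' σ t s :=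
    mul_nonneg (by linarith) (approxError_nonneg s)
  rw [Real.rpow_two]
  nlinarith

end Comparison

end EFG

theorem mainTheorem7 {α ι : Type*} [Fintype α] [Fintype ι] (G : EFG α ι)
    (hG : G.PerfectRecall) (p : ℝ) (hp1 : 1 < p) (hp2 : p ≤ 2)
    (U : ℝ) (hU : G.BoundsRewards U) (t : ℕ) (ht : 0 < t)
    (R' : ℕ → ι → α → ℝ) (σ : ℕ → ι → α → ℝ)
    (hσ : G.IsRCFR (EFG.polyLink p) R' t σ) :
    (∀ i : Fin 2,
      1 / (t : ℝ) * G.extRegret σ t i ≤ G.regretBound p U R' σ t i ∧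
      G.regretBound p U R' σ t i ≤ 1 / (t : ℝ) * (((G.infoStates i).card : ℝ) *
        ((t : ℝ) * (2 * U) ^ p * ((Fintype.card α : ℝ) - 1)
          + 2 * U * G.maxApproxError p R' σ t i) ^ (1 / p))) ∧
    (∀ τ : ι → α → ℝ, G.IsAverageProfile σ t τ →
      G.IsNash (G.regretBound p U R' σ t 0 + G.regretBound p U R' σ t 1) τ) ∧
    (p = 2 → ∀ i : Fin 2,
      (G.regretBound p U R' σ t i ≤ 1 / (t : ℝ) * ∑ s ∈ G.infoStates i,
        √((t : ℝ) * (2 * U) ^ 2 * ((G.infoActions s).card : ℝ)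
          + 2 * U * √((G.infoActions s).card : ℝ) * G.approxError p R' σ t s)) ∧
      (0 < U → (G.infoStates i).Nonempty →
        G.regretBound p U R' σ t i < 1 / (t : ℝ) * ∑ s ∈ G.infoStates i,
          √((t : ℝ) * (2 * U) ^ 2 * ((G.infoActions s).card : ℝ)
            + 2 * U * √((G.infoActions s).card : ℝ) * G.approxError p R' σ t s))) := by
  have hprof : ∀ k < t, G.IsProfile (σ (k + 1)) := fun k hk => (hσ k hk).1
  refine ⟨fun i => ⟨EFG.extRegret_le hG hp1 hp2 hU ht hσ i, EFG.regretBound_le hp1 hU ht hσ i⟩, ?_, ?_⟩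
  · intro τ hτ i x hx
    have H := fun {i j : Fin 2} (hij : i ≠ j) => EFG.value_deviate_average_le hG ht hprof hτ
      (ε := fun i => G.regretBound p U R' σ t i)
      (fun i x hx => EFG.sum_value_deviate_sub_le hG hp1 hp2 hU ht hσ hx i) hij hx
    have hi : i = 0 ∨ i = 1 := by omega
    rcases hi with rfl | rfl
    · exact H zero_ne_one
    · rw [add_comm (G.regretBound p U R' σ t 0)]
      exact H one_ne_zero
  · rintro rfl i
    have ht' : (0 : ℝ) < t := by exact_mod_cast ht
    refine ⟨mul_le_mul_of_nonneg_left (Finset.sum_le_sum fun s _ => ?_) (by positivity),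
      fun hU0 hne => mul_lt_mul_of_pos_left (Finset.sum_lt_sum_of_nonempty hne fun s _ => ?_)
        (by positivity)⟩
    · have hU0 : 0 ≤ U := EFG.bound_nonneg hU (hprof 0 ht) s
      rw [← Real.sqrt_eq_rpow]
      refine Real.sqrt_le_sqrt (le_trans ?_ (EFG.regretBase_two_le hU0 s))
      have : 0 ≤ (t : ℝ) * (2 * U) ^ 2 := by positivity
      linarith
    · rw [← Real.sqrt_eq_rpow]
      refine Real.sqrt_lt_sqrt (EFG.regretBase_nonneg 2 hU0.le s)
        (lt_of_lt_of_le ?_ (EFG.regretBase_two_le hU0.le s))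
      have : 0 < (t : ℝ) * (2 * U) ^ 2 := by positivity
      linarith
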